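/- **Setting.** Consider a finite-horizon, undiscounted distributionally robust Markov decision process with finite state space $\mathcal S$, finite nonempty action sets $\mathcal A_s$, and horizon $T<\infty$. Each state belongs to exactly one stage, $\mathcal S=\bigsqcup_{t=1}^T\mathcal S_t$. The uncertain parameters at $s$ are $(\tilde{\boldsymbol p}_s,\tilde{\boldsymbol r}_s)$ with $\boldsymbol p_s=(p(s'|s,a))_{a\in\mathcal A_s,s'\in\mathcal S}\in\mathbb R^{I_{s1}}$, $I_{s1}=|\mathcal S||\mathcal A_s|$, and $\boldsymbol r_s=(r(s,a))_{a\in\mathcal A_s}\in\mathbb R^{I_{s2}}$, $I_{s2}=|\mathcal A_s|$. For each $s$ the lifted ambiguity set $\mathcal G_s$ is the set of all Borel probability distributions $\mathbb P$ of $(\tilde{\boldsymbol p}_s,\tilde{\boldsymbol r}_s,\tilde n_s)$ on $\mathbb R^{I_{s1}}\times\mathbb R^{I_{s2}}\times[N_s]$ such that, for some $\boldsymbol\omega\in\mathcal W$ and $(\boldsymbol\mu_j,\boldsymbol\nu_j)\in\mathcal U_j$ $(j\in[J_s])$, $$\mathbb E_{\mathbb P}[(\tilde{\boldsymbol p}_s,\tilde{\boldsymbol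 r}_s)\mid\tilde n_s\in\mathcal N_j]=\boldsymbol\mu_j,\qquad \mathbb E_{\mathbb P}[\boldsymbol g_{j\tilde n_s}(\tilde{\boldsymbol p}_s,\tilde{\boldsymbol r}_s)\mid\tilde n_s\in\mathcal N_j]\le\boldsymbol\nu_j\qquad\forall j\in[J_s],$$ $$\mathbb P[(\tilde{\boldsymbol p}_s,\tilde{\boldsymbol r}_s)\in\mathcal D_n\mid\tilde n_s=n]=1,\qquad \mathbb P[\tilde n_s=n]=\omega_n\qquad\forall n\in[N_s].$$ The data, which may differ from state to state, satisfy: $\emptyset\ne\mathcal N_j\subseteq[N_s]$; for $n\in\mathcal N_j$ the components of $\boldsymbol g_{jn}:\mathbb R^{I_{s1}+I_{s2}}\to\mathbb R^{M_j}$ are convex and lower semicontinuous; $\mathcal D_n\subseteq\mathbb R^{I_{s1}+I_{s2}}$ and $\mathcal U_j\subseteq\mathbb R^{I_{s1}+I_{s2}+M_j}$ are convex and compact; $\mathcal W$ is convex and contained in the relative interior $\{\boldsymbol w\in\mathbb R^{N_s}\mid \boldsymbol w>\boldsymbol 0,\ \boldsymbol e^\top\boldsymbol w=1\}$ of the probability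 simplex. Put $\mathcal J_n=\{j\in[J_s]\mid n\in\mathcal N_j\}$. The $\mathcal S$-robust values are defined backwards by $v_T(s)=0$ for $s\in\mathcal S_T$ and, for $s\in\mathcal S_t$ with $t<T$, $$v_t(s)=\sup_{\boldsymbol\pi_s\in\mathcal P(\mathcal A_s)}\inf_{\mathbb P\in\mathcal G_s}\mathbb E_{\mathbb P}\Big[\sum_{a\in\mathcal A_s}\pi_s(a)\Big(\tilde r(s,a)+\sum_{s'\in\mathcal S_{t+1}}\tilde p(s'|s,a)\,v_{t+1}(s')\Big)\Big],$$ where $\mathcal P(\mathcal A_s)$ is the probability simplex. An $\mathcal S$-robust randomized action at $s$ is a $\boldsymbol\pi_s\in\mathcal P(\mathcal A_s)$ that attains this supremum. Let $\boldsymbol V_{t+1,s}$ be the matrix with $\boldsymbol p_s^\top\boldsymbol V_{t+1,s}\boldsymbol\pi_s=\sum_{a}\pi_s(a)\sum_{s'\in\mathcal S_{t+1}}p(s'|s,a)v_{t+1}(s')$ (block diagonal, one copy of $\boldsymbol v_{t+1}$ per action). **Slater's condition** at $s$: there are $\boldsymbol\xi_n,\boldsymbol\zeta_{jn},\boldsymbol\phi_j,\boldsymbol\varphi_j,\boldsymbol\tau$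 with $$\sum_{n\in\mathcal N_j}\boldsymbol\xi_n=\boldsymbol\phi_j,\quad \sum_{n\in\mathcal N_j}\boldsymbol\zeta_{jn}<\boldsymbol\varphi_j,\quad \frac{(\boldsymbol\phi_j,\boldsymbol\varphi_j)}{\sum_{i\in\mathcal N_j}\tau_i}\in\operatorname{ri}\,\mathcal U_j\quad\forall j\in[J_s],$$ $$\frac{\boldsymbol\zeta_{jn}}{\tau_n}>\boldsymbol g_{jn}\Big(\frac{\boldsymbol\xi_n}{\tau_n}\Big)\ \ \forall n\in[N_s],\,j\in\mathcal J_n,\qquad \frac{\boldsymbol\xi_n}{\tau_n}\in\operatorname{ri}\,\mathcal D_n\ \ \forall n\in[N_s],\qquad \boldsymbol\tau\in\operatorname{ri}\,\mathcal W$$ (componentwise inequalities, $\operatorname{ri}$ the relative interior). **Theorem.** Let $t<T$ and $s\in\mathcal S_t$. 1. The $\mathcal S$-robust randomized actions at $s$ are exactly the optimal solutions of $$\max_{\boldsymbol\pi_s\in\mathcal P(\mathcal A_s)}\ \inf_{\mathbb P\in\mathcal G_s}\ \mathbb E_{\mathbb P}\big[\tilde{\boldsymbol r}_s^\top\boldsymbol\pi_s+\tilde{\boldsymbol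 p}_s^\top\boldsymbol V_{t+1,s}\boldsymbol\pi_s\big].\qquad(\mathrm{A})$$ 2. Suppose that Slater's condition holds at every state of a stage before $T$. Then (A) is equivalent to the classical robust optimization problem $$\begin{array}{rll}\max&-\delta\\ \text{s.t.}&\displaystyle\delta\ge\boldsymbol\alpha^\top\boldsymbol\omega+\sum_{j\in[J_s]}(\boldsymbol\beta_j^\top\boldsymbol\mu_j+\boldsymbol\gamma_j^\top\boldsymbol\nu_j)&\forall(\boldsymbol\mu,\boldsymbol\nu,\boldsymbol\omega)\in\mathcal V\\ &\displaystyle\alpha_n+\sum_{j\in\mathcal J_n}\big(\boldsymbol\beta_j^\top(\boldsymbol p_s,\boldsymbol r_s)+\boldsymbol\gamma_j^\top\boldsymbol g_{jn}(\boldsymbol p_s,\boldsymbol r_s)\big)\ge-\boldsymbol r_s^\top\boldsymbol\pi_s-\boldsymbol p_s^\top\boldsymbol V_{t+1,s}\boldsymbol\pi_s&\forall(\boldsymbol p_s,\boldsymbol r_s)\in\mathcal D_n,\ n\in[N_s]\\ &\boldsymbol\pi_s\in\mathcal P(\mathcal A_s),\ \delta\in\mathbb R,\ \boldsymbol\alpha\in\mathbb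 R^{N_s},\ \boldsymbol\beta_j\in\mathbb R^{I_{s1}+I_{s2}},\ \boldsymbol\gamma_j\in\mathbb R^{M_j}_+&\forall j\in[J_s]\end{array}\qquad(\mathrm{B})$$ where $$\mathcal V=\Big\{(\boldsymbol\mu,\boldsymbol\nu,\boldsymbol\omega)\ \Big|\ \boldsymbol\omega\in\mathcal W,\ \frac{(\boldsymbol\mu_j,\boldsymbol\nu_j)}{\sum_{i\in\mathcal N_j}\omega_i}\in\mathcal U_j\ \ \forall j\in[J_s]\Big\}.$$ That is, $\boldsymbol\pi_s$ is an $\mathcal S$-robust randomized action if and only if there are $\delta,\boldsymbol\alpha,(\boldsymbol\beta_j),(\boldsymbol\gamma_j)$ such that $(\boldsymbol\pi_s,\delta,\boldsymbol\alpha,\boldsymbol\beta,\boldsymbol\gamma)$ is an optimal solution of (B). Moreover, the maxima in (A) and (B) are both attained and both equal $v_t(s)$, and $\mathcal V$ and the feasible set of (B) are convex. -/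

import Mathlib

open MeasureTheory ProbabilityTheory

namespace DRMDP

/-- The parameters `(p_s, r_s)` of one state with action set `A`: the entry `p (a, s')` is the
probability `p(s' | s, a)` and `r a` is the reward `r(s, a)`. -/
abbrev Param (S A : Type*) : Type _ := (A × S → ℝ) × (A → ℝ)

/-- The Euclidean pairing `βᵀ (p, r)`. -/
def pair {S A : Type*} [Fintype S] [Fintype A] (β z : Param S A) : ℝ :=
  β.1 ⬝ᵥ z.1 + β.2 ⬝ᵥ z.2

/-- The data of a lifted state-wise ambiguity set: `N` scenarios, `J` groups of conditional moment
constraints, the scenario sets `𝒩_j` (`scen j`), the moment functions `g_{jn}` (only those with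
`n ∈ 𝒩_j` matter), the supports `D_n`, the moment uncertainty sets `U_j`, and the set `W` of
scenario probabilities, contained in the relative interior of the probability simplex. -/
structure AmbiguityFormat (S A : Type*) [Fintype S] [Fintype A] where
  N : ℕ
  J : ℕ
  M : Fin J → ℕ
  scen : Fin J → Finset (Fin N)
  g : (j : Fin J) → Fin N → Param S A → (Fin (M j) → ℝ)
  D : Fin N → Set (Param S A)
  U : (j : Fin J) → Set (Param S A × (Fin (M j) → ℝ))
  W : Set (Fin N → ℝ)
  scen_nonempty : ∀ j, (scen j).Nonempty
  g_convex : ∀ j, ∀ n ∈ scen j, ∀ m, ConvexOn ℝ Set.univ (fun z => g j n z m)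
  g_lsc : ∀ j, ∀ n ∈ scen j, ∀ m, LowerSemicontinuous (fun z => g j n z m)
  D_convex : ∀ n, Convex ℝ (D n)
  D_compact : ∀ n, IsCompact (D n)
  U_convex : ∀ j, Convex ℝ (U j)
  U_compact : ∀ j, IsCompact (U j)
  W_convex : Convex ℝ W
  W_interior : ∀ w ∈ W, (∀ n, 0 < w n) ∧ ∑ n, w n = 1

namespace AmbiguityFormat

variable {S A : Type*} [Fintype S] [Fintype A] (F : AmbiguityFormat S A)

/-- The lifted ambiguity set `𝒢_s`: the joint laws of `(p_s, r_s, n_s)` that meet the conditional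
moment, support and scenario-probability constraints for some admissible `ω`, `μ`, `ν`.
`P[|B]` is the conditional law given the event `B`. -/
def ambiguitySet : Set (Measure (Param S A × Fin F.N)) :=
  {P | IsProbabilityMeasure P ∧
    ∃ ω ∈ F.W, ∃ (μ : Fin F.J → Param S A) (ν : (j : Fin F.J) → Fin (F.M j) → ℝ),
      (∀ j, (μ j, ν j) ∈ F.U j) ∧
      (∀ j, ∫ x, x.1 ∂P[|{x | x.2 ∈ F.scen j}] = μ j) ∧
      (∀ j m, ∫ x, F.g j x.2 x.1 m ∂P[|{x | x.2 ∈ F.scen j}] ≤ ν j m) ∧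
      (∀ n, P[|{x | x.2 = n}] {x | x.1 ∈ F.D n} = 1) ∧
      (∀ n, P {x | x.2 = n} = ENNReal.ofReal (ω n))}

/-- Slater's condition: the system
`∑_{n ∈ 𝒩_j} ξ_n = φ_j`, `∑_{n ∈ 𝒩_j} ζ_{jn} ≤ ψ_j`, `ζ_{jn} / τ_n ≥ g_{jn} (ξ_n / τ_n)`,
`ξ_n / τ_n ∈ D_n`, `(φ_j, ψ_j) / ∑_{i ∈ 𝒩_j} τ_i ∈ U_j`, `τ ∈ W`
has a solution that satisfies the linear equations and lies in the relative interior of each of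
the other (conic) constraints. -/
def Slater : Prop :=
  ∃ (ξ : Fin F.N → Param S A) (ζ : (j : Fin F.J) → Fin F.N → (Fin (F.M j) → ℝ))
    (φ : Fin F.J → Param S A) (ψ : (j : Fin F.J) → (Fin (F.M j) → ℝ)) (τ : Fin F.N → ℝ),
    (∀ j, ∑ n ∈ F.scen j, ξ n = φ j) ∧
    (∀ j m, ∑ n ∈ F.scen j, ζ j n m < ψ j m) ∧
    (∀ j, ∀ n ∈ F.scen j, ∀ m, F.g j n ((τ n)⁻¹ • ξ n) m < ζ j n m / τ n) ∧
    (∀ n, (τ n)⁻¹ • ξ n ∈ intrinsicInterior ℝ (F.D n)) ∧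
    (∀ j, (∑ i ∈ F.scen j, τ i)⁻¹ • (φ j, ψ j) ∈ intrinsicInterior ℝ (F.U j)) ∧
    τ ∈ intrinsicInterior ℝ F.W

/-- The set `𝒱` of triples `(μ, ν, ω)`. -/
def V : Set ((Fin F.J → Param S A) × ((j : Fin F.J) → Fin (F.M j) → ℝ) × (Fin F.N → ℝ)) :=
  {x | x.2.2 ∈ F.W ∧ ∀ j, (∑ i ∈ F.scen j, x.2.2 i)⁻¹ • (x.1 j, x.2.1 j) ∈ F.U j}

/-- The decision variables `(π, δ, α, β, γ)` of the classical robust problem. -/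
abbrev RobustVars : Type _ :=
  (A → ℝ) × ℝ × (Fin F.N → ℝ) × (Fin F.J → Param S A) × ((j : Fin F.J) → Fin (F.M j) → ℝ)

end AmbiguityFormat

/-- A finite-horizon distributionally robust MDP with finite state space `S`, action sets `A s`,
horizon `T` and state-wise lifted ambiguity sets. Each state belongs to exactly one stage, so
`𝒮_t = {s | stage s = t}`. -/
structure Model (S : Type*) (A : S → Type*) [Fintype S] [∀ s, Fintype (A s)] where
  T : ℕ
  stage : S → ℕ
  one_le_stage : ∀ s, 1 ≤ stage s
  stage_le : ∀ s, stage s ≤ T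
  format : (s : S) → AmbiguityFormat S (A s)

namespace Model

variable {S : Type*} {A : S → Type*} [Fintype S] [∀ s, Fintype (A s)] (𝓜 : Model S A)

/-- `∑_a π(a) (r(s,a) + ∑_{s' ∈ 𝒮_{t+1}} p(s'|s,a) v(s'))`. -/
def payoff (t : ℕ) (s : S) (v : S → ℝ) (π : A s → ℝ) (z : Param S (A s)) : ℝ :=
  ∑ a, π a * (z.2 a + ∑ s' with 𝓜.stage s' = t + 1, z.1 (a, s') * v s')

/-- The worst-case expected payoff over the lifted ambiguity set of `s`. -/
noncomputable def worstCase (t : ℕ) (s : S) (v : S → ℝ) (π : A s → ℝ) : ℝ :=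
  sInf ((fun P : Measure (Param S (A s) × Fin (𝓜.format s).N) =>
    ∫ x, 𝓜.payoff t s v π x.1 ∂P) '' (𝓜.format s).ambiguitySet)

/-- Backward induction: `valueToGo k` is the `𝒮`-robust value at stage `T - k`. -/
noncomputable def valueToGo : ℕ → S → ℝ
  | 0 => fun _ => 0
  | k + 1 => fun s =>
      sSup ((fun π => 𝓜.worstCase (𝓜.T - (k + 1)) s (valueToGo k) π) '' stdSimplex ℝ (A s))

/-- The `𝒮`-robust value `v_t(s)`, meant for `t ≤ T` and `s ∈ 𝒮_t`. -/
noncomputable def value (t : ℕ) : S → ℝ := 𝓜.valueToGo (𝓜.T - t)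

theorem value_terminal (s : S) : 𝓜.value 𝓜.T s = 0 := by
  simp [value, valueToGo]

theorem value_of_lt (t : ℕ) (ht : t < 𝓜.T) (s : S) :
    𝓜.value t s =
      sSup ((fun π => 𝓜.worstCase t s (𝓜.value (t + 1)) π) '' stdSimplex ℝ (A s)) := by
  have h1 : 𝓜.T - t = (𝓜.T - (t + 1)) + 1 := by omega
  have h2 : 𝓜.T - ((𝓜.T - (t + 1)) + 1) = t := by omega
  simp only [value, h1, valueToGo, h2]

/-- `π` is an `𝒮`-robust randomized action at the state `s` of stage `t`. -/
def IsSRobustAction (t : ℕ) (s : S) (π : A s → ℝ) : Prop :=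
  π ∈ stdSimplex ℝ (A s) ∧
    ∀ π' ∈ stdSimplex ℝ (A s),
      𝓜.worstCase t s (𝓜.value (t + 1)) π' ≤ 𝓜.worstCase t s (𝓜.value (t + 1)) π

open scoped Classical in
/-- The block-diagonal matrix `V_{t+1,s}` with a copy of `v_{t+1}` for each action. Its rows are
indexed by `A s × S`; those of states outside `𝒮_{t+1}` are zero. -/
noncomputable def V (t : ℕ) (s : S) : Matrix (A s × S) (A s) ℝ :=
  Matrix.of fun i a => if i.1 = a ∧ 𝓜.stage i.2 = t + 1 then 𝓜.value (t + 1) i.2 else 0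

/-- `rᵀ π + pᵀ V_{t+1,s} π`. -/
noncomputable def objective (t : ℕ) (s : S) (π : A s → ℝ) (z : Param S (A s)) : ℝ :=
  z.2 ⬝ᵥ π + z.1 ⬝ᵥ (𝓜.V t s).mulVec π

/-- `inf_{P ∈ 𝒢_s} E_P [rᵀ π + pᵀ V_{t+1,s} π]`. -/
noncomputable def infObjective (t : ℕ) (s : S) (π : A s → ℝ) : ℝ :=
  sInf ((fun P : Measure (Param S (A s) × Fin (𝓜.format s).N) =>
    ∫ x, 𝓜.objective t s π x.1 ∂P) '' (𝓜.format s).ambiguitySet)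

/-- The feasible set of the classical robust problem. -/
def robustFeasible (t : ℕ) (s : S) : Set (𝓜.format s).RobustVars :=
  {x | match x with
    | (π, δ, α, β, γ) =>
      (∀ μ ν ω, (μ, ν, ω) ∈ (𝓜.format s).V →
        α ⬝ᵥ ω + ∑ j, (pair (β j) (μ j) + γ j ⬝ᵥ ν j) ≤ δ) ∧
      (∀ n, ∀ z ∈ (𝓜.format s).D n,
        -(𝓜.objective t s π z) ≤
          α n + ∑ j with n ∈ (𝓜.format s).scen j,
            (pair (β j) z + γ j ⬝ᵥ (𝓜.format s).g j n z)) ∧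
      π ∈ stdSimplex ℝ (A s) ∧
      (∀ j m, 0 ≤ γ j m)}

/-- `x = (π, δ, α, β, γ)` maximizes `-δ` over the feasible set of the classical robust problem. -/
def IsRobustOptimal (t : ℕ) (s : S) (x : (𝓜.format s).RobustVars) : Prop :=
  x ∈ 𝓜.robustFeasible t s ∧ ∀ y ∈ 𝓜.robustFeasible t s, -y.2.1 ≤ -x.2.1

end Model

end DRMDP

/-! Part 1 holds because the matrix form of the objective is the Bellman payoff. Part 2 is conic
duality for a moment problem, applied for each fixed policy.

Fix `π`, so that the payoff is a linear function `c` of the parameters, and let `p` be its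
worst-case expectation. Weak duality: integrating the second constraint of (B) against any
admissible law and applying the first constraint to its unnormalized moments gives `-δ ≤ p`.

Strong duality needs only laws with one atom per scenario. Their unnormalized moments and costs form
the convex set `momentCone`, closed under nonnegative scaling, and every cost over a point of `V` is
at least `p`. Under Slater's condition both `V` and the projection of this cone contain a common
point that can be moved slightly away from any other point, so a non-vertical separating functional
exists (`exists_linear_price`). Its coordinates are `α`, `β`, `γ`: the apex of the cone yields the
first constraint of (B) with `δ = -p`, and its rays yield the second constraint and `γ ≥ 0`. Hence
(B) with `π` fixed attains the value `p` (`Slater.exists_dual`).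

The maximum in (A) is attained since an infimum of linear functions of `π` is upper semicontinuous
on the compact simplex; with duality, optimality transfers between (A) and (B). -/

open Filter Topology
open scoped Pointwise

/-! ### Proper separation and convex duality in finite dimension -/

section ConvexSeparation

variable {E : Type*} [NormedAddCommGroup E] [NormedSpace ℝ E]

/-- If `0` lies in the affine span, that span is the whole space, so `C` has interior and
Hahn–Banach applies; the nonzero functional cannot vanish on a spanning set. Otherwise `0` is
strictly separated from the closed affine span. -/
theorem Convex.exists_nonneg_of_span_eq_top [FiniteDimensional ℝ E] {C : Set E}
    (hC : Convex ℝ C) (hne : C.Nonempty) (h0 : (0 : E) ∉ C) (hspan : Submodule.span ℝ C = ⊤) :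
    ∃ f : E →ₗ[ℝ] ℝ, (∀ x ∈ C, 0 ≤ f x) ∧ ∃ x ∈ C, 0 < f x := by
  by_cases hA : (0 : E) ∈ affineSpan ℝ C
  · have htop : affineSpan ℝ C = ⊤ := by
      rw [← affineSpan_insert_eq_affineSpan ℝ hA]
      apply SetLike.coe_injective
      rw [affineSpan_insert_zero, hspan]
      rfl
    have hint := (hC.interior_nonempty_iff_affineSpan_eq_top).2 htop
    obtain ⟨f, hf, hle⟩ := geometric_hahn_banach_of_nonempty_interior_point hC
      (fun h => h0 (interior_subset h)) hint
    refine ⟨-f.toLinearMap, fun x hx => by simpa using hle x hx, ?_⟩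
    by_contra! hcon
    refine hf (ContinuousLinearMap.coe_injective (LinearMap.ext_on hspan fun x hx => ?_))
    have h1 := hcon x hx
    have h2 := hle x hx
    simp at h1 h2 ⊢
    linarith
  · have hcl : IsClosed (affineSpan ℝ C : Set E) := AffineSubspace.closed_of_finiteDimensional _
    obtain ⟨f, u, hu, hf⟩ := geometric_hahn_banach_point_closed
      (affineSpan ℝ C).convex hcl hA
    have hpos : ∀ x ∈ C, 0 < f x := fun x hx => by
      have := hf x (subset_affineSpan ℝ C hx)
      rw [map_zero] at hu
      linarith
    obtain ⟨x, hx⟩ := hne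
    exact ⟨f.toLinearMap, fun x hx => (hpos x hx).le, x, hx, hpos x hx⟩

/-- Proper separation of a point from a convex set in finite dimension. -/
theorem Convex.exists_nonneg_of_zero_notMem [FiniteDimensional ℝ E] {C : Set E}
    (hC : Convex ℝ C) (hne : C.Nonempty) (h0 : (0 : E) ∉ C) :
    ∃ f : E →ₗ[ℝ] ℝ, (∀ x ∈ C, 0 ≤ f x) ∧ ∃ x ∈ C, 0 < f x := by
  set p := Submodule.span ℝ C with hp
  have hsub : ∀ x ∈ C, x ∈ p := fun x hx => Submodule.subset_span hx
  obtain ⟨f, hf, x, hx, hfx⟩ := Convex.exists_nonneg_of_span_eq_top (E := p)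
    (C := p.subtype ⁻¹' C) (hC.linear_preimage p.subtype)
    (let ⟨x, hx⟩ := hne; ⟨⟨x, hsub x hx⟩, hx⟩)
    (by simpa using h0) (Submodule.span_span_coe_preimage)
  obtain ⟨g, hg⟩ := LinearMap.exists_extend f
  have hgf : ∀ y : p, g y = f y := fun y => by rw [← hg]; rfl
  exact ⟨g, fun y hy => by simpa [← hgf] using hf ⟨y, hsub y hy⟩ hy,
    x, hx, by rwa [hgf]⟩

/-- A point of the relative interior can be moved slightly away from any other point of the set. -/
theorem eventually_add_smul_sub_mem_of_mem_intrinsicInterior {C : Set E} {x₀ x : E}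
    (hx₀ : x₀ ∈ intrinsicInterior ℝ C) (hx : x ∈ C) :
    ∀ᶠ η : ℝ in 𝓝 0, x₀ + η • (x₀ - x) ∈ C := by
  obtain ⟨y, hy, rfl⟩ := mem_intrinsicInterior.1 hx₀
  have hmem : ∀ η : ℝ, (y : E) + η • ((y : E) - x) ∈ affineSpan ℝ C := fun η => by
    have h := AffineMap.lineMap_mem (1 + η) (subset_affineSpan ℝ C hx) y.2
    rw [AffineMap.lineMap_apply_module'] at h
    convert h using 1
    module
  -- The moving point stays in the affine span, where the relative interior is an honest
  -- neighbourhood.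
  let φ : ℝ → affineSpan ℝ C := fun η => ⟨_, hmem η⟩
  have hφ : Continuous φ := by
    refine Continuous.subtype_mk ?_ _
    fun_prop
  have hφ0 : φ 0 = y := by ext; simp [φ]
  have h1 : interior ((↑) ⁻¹' C : Set (affineSpan ℝ C)) ∈ 𝓝 (φ 0) := by
    rw [hφ0]; exact isOpen_interior.mem_nhds hy
  filter_upwards [hφ.continuousAt h1] with η hη
  exact interior_subset (s := ((↑) ⁻¹' C : Set (affineSpan ℝ C))) hη

/-- Convex duality with attainment: if `p` bounds the fibres of `C₂` over `C₁` from below and `x₀`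
is a relatively interior point of both `C₁` and the projection of `C₂`, there is a linear price
that makes the bound unconstrained. -/
theorem exists_linear_price [FiniteDimensional ℝ E] {C₁ : Set E} {C₂ : Set (E × ℝ)}
    (hC₁ : Convex ℝ C₁) (hC₂ : Convex ℝ C₂) {p : ℝ}
    (hp : ∀ x ∈ C₁, ∀ h, (x, h) ∈ C₂ → p ≤ h) {x₀ : E} (hx₁ : x₀ ∈ C₁)
    (hx₂ : ∃ h, (x₀, h) ∈ C₂)
    (habs₁ : ∀ x ∈ C₁, ∃ ε : ℝ, 0 < ε ∧ x₀ + ε • (x₀ - x) ∈ C₁)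
    (habs₂ : ∀ y ∈ C₂, ∃ ε : ℝ, 0 < ε ∧ ∃ h, (x₀ + ε • (x₀ - y.1), h) ∈ C₂) :
    ∃ l : E →ₗ[ℝ] ℝ, ∀ x ∈ C₁, ∀ y ∈ C₂, l x + p ≤ l y.1 + y.2 := by
  obtain ⟨h₀, hx₂⟩ := hx₂
  have hconv : Convex ℝ (C₂ - C₁ ×ˢ Set.Iio p) := hC₂.sub (hC₁.prod (convex_Iio p))
  have hzero : (0 : E × ℝ) ∉ C₂ - C₁ ×ˢ Set.Iio p := by
    rintro ⟨⟨y, h⟩, hy, ⟨x, q⟩, ⟨hx, hq⟩, hyx⟩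
    simp only [Prod.mk_sub_mk, Prod.mk_eq_zero, sub_eq_zero] at hyx
    obtain ⟨rfl, rfl⟩ := hyx
    exact absurd (hp _ hx _ hy) (not_le.2 hq)
  have hne : (C₂ - C₁ ×ˢ Set.Iio p).Nonempty :=
    ⟨_, (x₀, h₀), hx₂, (x₀, p - 1), ⟨hx₁, by simp⟩, rfl⟩
  obtain ⟨f, hf, w, hw, hfw⟩ := hconv.exists_nonneg_of_zero_notMem hne hzero
  set l : E →ₗ[ℝ] ℝ := f ∘ₗ LinearMap.inl ℝ E ℝ with hl
  set κ : ℝ := f (0, 1) with hκ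
  have hfl : ∀ x r, f (x, r) = l x + κ * r := fun x r => by
    have : ((x, r) : E × ℝ) = (x, 0) + r • (0, 1) := by simp
    rw [this, map_add, map_smul, smul_eq_mul, mul_comm]
    rfl
  have hsep : ∀ x ∈ C₁, ∀ y ∈ C₂, ∀ q < p, l x + κ * q ≤ l y.1 + κ * y.2 := by
    intro x hx y hy q hq
    have := hf _ (Set.sub_mem_sub hy (Set.mk_mem_prod hx (Set.mem_Iio.2 hq)))
    rw [map_sub, hfl, ← Prod.mk.eta (p := y), hfl] at this
    linarith
  have hκ0 : 0 ≤ κ := by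
    -- A negative `κ` fails at `x₀` for any `q` below both `p` and `h₀`.
    by_contra! hneg
    have h1 := hsep x₀ hx₁ _ hx₂ (min (p - 1) (h₀ - 1))
      ((min_le_left _ _).trans_lt (by linarith))
    have h2 := min_le_right (p - 1) (h₀ - 1)
    simp only at h1
    nlinarith
  rcases hκ0.eq_or_lt with hκ0 | hκ0
  -- For `κ = 0` the functional `l` separates `C₁` from the projection of `C₂`. Moving `x₀` away
  -- from `x` and from `y` inside these sets gives `l y ≤ l x₀ ≤ l x`, which contradicts proper
  -- separation at `w`.
  · exfalso
    have hsep' : ∀ x ∈ C₁, ∀ y ∈ C₂, l x ≤ l y.1 := fun x hx y hy => by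
      have := hsep x hx y hy (p - 1) (by linarith)
      simpa [← hκ0] using this
    obtain ⟨y, hy, ⟨x, q⟩, ⟨hx, hq⟩, rfl⟩ := hw
    rw [map_sub, hfl, ← Prod.mk.eta (p := y), hfl, ← hκ0] at hfw
    obtain ⟨ε, hε, h1⟩ := habs₁ x hx
    obtain ⟨ε', hε', h, h2⟩ := habs₂ y hy
    have h3 := hsep' _ h1 _ hx₂
    have h4 := hsep' _ hx₁ _ h2
    simp only [map_add, map_smul, map_sub, smul_eq_mul] at h3 h4
    have h5 : l x₀ - l x ≤ 0 := by by_contra! hlt; linarith [mul_pos hε hlt]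
    have h6 : 0 ≤ l x₀ - l y.1 := by by_contra! hlt; linarith [mul_neg_of_pos_of_neg hε' hlt]
    simp only at hfw
    linarith
  · refine ⟨κ⁻¹ • l, fun x hx y hy => ?_⟩
    have hlim : ∀ q < p, κ⁻¹ * l x + q ≤ κ⁻¹ * l y.1 + y.2 := fun q hq => by
      have := mul_le_mul_of_nonneg_left (hsep x hx y hy q hq) (inv_nonneg.2 hκ0.le)
      rwa [mul_add, mul_add, inv_mul_cancel_left₀ hκ0.ne', inv_mul_cancel_left₀ hκ0.ne'] at this
    have := le_of_forall_lt_imp_le_of_dense (a₂ := p) (a₁ := κ⁻¹ * l y.1 + y.2 - κ⁻¹ * l x)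
      (fun q hq => by linarith [hlim q hq])
    simp only [LinearMap.smul_apply, smul_eq_mul]
    linarith

/-- Convex combination of two points with unnormalized weights, Jensen's inequality included. -/
theorem Convex.exists_weighted_combination {F : Type*} [AddCommGroup F] [Module ℝ F] {C : Set F}
    (hC : Convex ℝ C) {x y : F} (hx : x ∈ C) (hy : y ∈ C) {a b : ℝ} (ha : 0 ≤ a) (hb : 0 ≤ b) :
    ∃ z ∈ C, (a + b) • z = a • x + b • y ∧
      ∀ g : F → ℝ, ConvexOn ℝ Set.univ g → (a + b) * g z ≤ a * g x + b * g y := by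
  rcases (add_nonneg ha hb).eq_or_lt with h | h
  · obtain ⟨rfl, rfl⟩ : a = 0 ∧ b = 0 := ⟨by linarith, by linarith⟩
    exact ⟨x, hx, by simp, by simp⟩
  · have hs : a / (a + b) + b / (a + b) = 1 := by field_simp
    have ha' := div_nonneg ha h.le
    have hb' := div_nonneg hb h.le
    refine ⟨_, hC hx hy ha' hb' hs, ?_, fun g hg => ?_⟩
    · rw [smul_add, smul_smul, smul_smul, mul_div_cancel₀ _ h.ne', mul_div_cancel₀ _ h.ne']
    · have := mul_le_mul_of_nonneg_left
        (hg.2 (Set.mem_univ x) (Set.mem_univ y) ha' hb' hs) h.le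
      rwa [smul_eq_mul, smul_eq_mul, mul_add, ← mul_assoc, ← mul_assoc,
        mul_div_cancel₀ _ h.ne', mul_div_cancel₀ _ h.ne'] at this

end ConvexSeparation

/-! ### Convexity and small moves for `V` and the moment cone -/

namespace DRMDP

namespace AmbiguityFormat

variable {S A : Type*} [Fintype S] [Fintype A] (F : AmbiguityFormat S A)

/-- The space of triples `(μ, ν, ω)`. -/
abbrev Moments : Type _ :=
  (Fin F.J → Param S A) × ((j : Fin F.J) → Fin (F.M j) → ℝ) × (Fin F.N → ℝ)

variable {F}

theorem g_continuous {j : Fin F.J} {n : Fin F.N} (hn : n ∈ F.scen j) (m : Fin (F.M j)) :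
    Continuous fun z => F.g j n z m :=
  continuousOn_univ.1 ((F.g_convex j n hn m).continuousOn isOpen_univ)

theorem sum_scen_pos {ω : Fin F.N → ℝ} (hω : ω ∈ F.W) (j : Fin F.J) :
    0 < ∑ n ∈ F.scen j, ω n :=
  Finset.sum_pos (fun n _ => (F.W_interior ω hω).1 n) (F.scen_nonempty j)

/-- Clearing the denominator presents `V` as a perspective set, the form suited to weighted
combinations. -/
theorem mem_V_iff {x : F.Moments} :
    x ∈ F.V ↔ x.2.2 ∈ F.W ∧ ∀ j, ∃ u ∈ F.U j,
      (∑ n ∈ F.scen j, x.2.2 n) • u = (x.1 j, x.2.1 j) := by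
  refine and_congr_right fun hω => forall_congr' fun j => ⟨fun h => ⟨_, h, ?_⟩, ?_⟩
  · rw [smul_inv_smul₀ (sum_scen_pos hω j).ne']
  · rintro ⟨u, hu, h⟩
    rwa [← h, inv_smul_smul₀ (sum_scen_pos hω j).ne']

theorem convex_V : Convex ℝ F.V := by
  intro x hx y hy a b ha hb hab
  rw [mem_V_iff] at hx hy ⊢
  refine ⟨F.W_convex hx.1 hy.1 ha hb hab, fun j => ?_⟩
  obtain ⟨u, hu, hxu⟩ := hx.2 j
  obtain ⟨v, hv, hyv⟩ := hy.2 j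
  obtain ⟨w, hw, hsum, -⟩ := (F.U_convex j).exists_weighted_combination hu hv
    (mul_nonneg ha (sum_scen_pos hx.1 j).le) (mul_nonneg hb (sum_scen_pos hy.1 j).le)
  refine ⟨w, hw, ?_⟩
  rw [mul_smul, mul_smul, hxu, hyv] at hsum
  calc _ = (a * ∑ n ∈ F.scen j, x.2.2 n + b * ∑ n ∈ F.scen j, y.2.2 n) • w := by
        simp [Finset.sum_add_distrib, Finset.mul_sum]
    _ = _ := by rw [hsum]; rfl

variable (F) in
/-- The unnormalized moments, with the expectation of `c`, of the discrete measures with one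
support point per scenario, relaxed upwards in the second component. -/
def momentCone (c : Param S A →ₗ[ℝ] ℝ) : Set (F.Moments × ℝ) :=
  {y | (∀ n, 0 ≤ y.1.2.2 n) ∧ ∃ z : Fin F.N → Param S A, (∀ n, z n ∈ F.D n) ∧
    (∀ j, ∑ n ∈ F.scen j, y.1.2.2 n • z n = y.1.1 j) ∧
    (∀ j m, ∑ n ∈ F.scen j, y.1.2.2 n * F.g j n (z n) m ≤ y.1.2.1 j m) ∧
    ∑ n, y.1.2.2 n * c (z n) = y.2}

/-- The products `ω n • z n` are not jointly convex in the data, but merging the two atoms of each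
scenario at their barycentre preserves total mass, first moment and cost. Jensen's inequality only
lowers the `g`-moments, which the upward relaxation absorbs. -/
theorem convex_momentCone (c : Param S A →ₗ[ℝ] ℝ) : Convex ℝ (F.momentCone c) := by
  rintro x ⟨hx0, z, hz, hx1, hx2, hx3⟩ y ⟨hy0, z', hz', hy1, hy2, hy3⟩ a b ha hb hab
  choose w hw hsum hg using fun n => (F.D_convex n).exists_weighted_combination (hz n) (hz' n)
    (mul_nonneg ha (hx0 n)) (mul_nonneg hb (hy0 n))
  have hval : ∀ n, (a • x + b • y).1.2.2 n = a * x.1.2.2 n + b * y.1.2.2 n := fun n => rfl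
  refine ⟨fun n => ?_, w, hw, fun j => ?_, fun j m => ?_, ?_⟩
  · rw [hval]
    exact add_nonneg (mul_nonneg ha (hx0 n)) (mul_nonneg hb (hy0 n))
  · simp only [hval, hsum, Finset.sum_add_distrib, mul_smul, ← Finset.smul_sum, hx1, hy1]
    rfl
  · calc _ ≤ ∑ n ∈ F.scen j, (a * x.1.2.2 n * F.g j n (z n) m
            + b * y.1.2.2 n * F.g j n (z' n) m) :=
          Finset.sum_le_sum fun n hn => by rw [hval]; exact hg n _ (F.g_convex j n hn m)
      _ = a * ∑ n ∈ F.scen j, x.1.2.2 n * F.g j n (z n) m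
            + b * ∑ n ∈ F.scen j, y.1.2.2 n * F.g j n (z' n) m := by
          simp only [Finset.sum_add_distrib, Finset.mul_sum, mul_assoc]
      _ ≤ a * x.1.2.1 j m + b * y.1.2.1 j m := by gcongr; exacts [hx2 j m, hy2 j m]
  · have hc : ∀ n, (a • x + b • y).1.2.2 n * c (w n)
        = a * (x.1.2.2 n * c (z n)) + b * (y.1.2.2 n * c (z' n)) := fun n => by
      rw [hval, ← smul_eq_mul, ← map_smul, hsum, map_add, map_smul, map_smul]
      simp only [smul_eq_mul, mul_assoc]
    simp only [hc, Finset.sum_add_distrib, ← Finset.mul_sum, hx3, hy3]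
    rfl

/-- A point of a strictly feasible scaled set stays inside after a small move. -/
theorem eventually_exists_smul_eq {E : Type*} [NormedAddCommGroup E] [NormedSpace ℝ E]
    {C : Set E} {u v : E} (hu : u ∈ intrinsicInterior ℝ C) (hv : v ∈ C) {r : ℝ} (hr : 0 < r)
    (r' : ℝ) :
    ∃ w : ℝ → E, Tendsto w (𝓝 0) (𝓝 u) ∧ ∀ᶠ ε : ℝ in 𝓝 0, w ε ∈ C ∧
      (r + ε * (r - r')) • w ε = r • u + ε • (r • u - r' • v) := by
  have hden : Tendsto (fun ε : ℝ => r + ε * (r - r')) (𝓝 0) (𝓝 r) :=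
    Continuous.tendsto' (by fun_prop) _ _ (by simp)
  have hη : Tendsto (fun ε : ℝ => ε * r' / (r + ε * (r - r'))) (𝓝 0) (𝓝 0) := by
    have h : Tendsto (fun ε : ℝ => ε * r') (𝓝 0) (𝓝 0) :=
      Continuous.tendsto' (by fun_prop) _ _ (by simp)
    have h' := h.div hden hr.ne'
    rwa [zero_div] at h'
  -- The coefficient solves the required identity for `w ε`; it tends to `0`, so `w ε` stays in `C`.
  refine ⟨fun ε => u + (ε * r' / (r + ε * (r - r'))) • (u - v), ?_, ?_⟩
  · simpa using tendsto_const_nhds.add (hη.smul_const (u - v))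
  · filter_upwards [hη.eventually (eventually_add_smul_sub_mem_of_mem_intrinsicInterior hu hv),
      hden.eventually (lt_mem_nhds hr)] with ε h1 h2
    refine ⟨h1, ?_⟩
    rw [smul_add, smul_smul, mul_div_cancel₀ _ h2.ne']
    module

/-- A solution of Slater's system, in terms of scenario-wise support points. -/
theorem Slater.exists_point (h : F.Slater) :
    ∃ (x : F.Moments) (z : Fin F.N → Param S A),
      x.2.2 ∈ intrinsicInterior ℝ F.W ∧
      (∀ j, ∃ u ∈ intrinsicInterior ℝ (F.U j),
        (∑ n ∈ F.scen j, x.2.2 n) • u = (x.1 j, x.2.1 j)) ∧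
      (∀ n, z n ∈ intrinsicInterior ℝ (F.D n)) ∧
      (∀ j, ∑ n ∈ F.scen j, x.2.2 n • z n = x.1 j) ∧
      (∀ j m, ∑ n ∈ F.scen j, x.2.2 n * F.g j n (z n) m < x.2.1 j m) := by
  obtain ⟨ξ, ζ, φ, ψ, τ, h1, h2, h3, h4, h5, h6⟩ := h
  have hτ := intrinsicInterior_subset h6
  have hpos := (F.W_interior τ hτ).1
  refine ⟨(φ, ψ, τ), fun n => (τ n)⁻¹ • ξ n, h6, fun j => ⟨_, h5 j, ?_⟩, h4, fun j => ?_,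
    fun j m => ?_⟩
  · rw [smul_inv_smul₀ (sum_scen_pos hτ j).ne']
  · refine Eq.trans ?_ (h1 j)
    exact Finset.sum_congr rfl fun n _ => smul_inv_smul₀ (hpos n).ne' _
  · refine lt_of_le_of_lt (Finset.sum_le_sum fun n hn => ?_) (h2 j m)
    have := (lt_div_iff₀' (hpos n)).1 (h3 j n hn m)
    exact this.le

/-- Each of the finitely many constraints survives for all small `ε`, so one positive `ε` serves
them all. -/
theorem exists_add_smul_mem_V {x₀ : F.Moments} (hW : x₀.2.2 ∈ intrinsicInterior ℝ F.W)
    (hU : ∀ j, ∃ u ∈ intrinsicInterior ℝ (F.U j),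
        (∑ n ∈ F.scen j, x₀.2.2 n) • u = (x₀.1 j, x₀.2.1 j)) {x : F.Moments} (hx : x ∈ F.V) :
    ∃ ε : ℝ, 0 < ε ∧ x₀ + ε • (x₀ - x) ∈ F.V := by
  rw [mem_V_iff] at hx
  choose u hu hxu using hU
  choose v hv hxv using hx.2
  choose w _ hw using fun j => eventually_exists_smul_eq (hu j) (hv j)
    (sum_scen_pos (intrinsicInterior_subset hW) j) (∑ n ∈ F.scen j, x.2.2 n)
  have hev : ∀ᶠ ε : ℝ in 𝓝 0, x₀ + ε • (x₀ - x) ∈ F.V := by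
    filter_upwards [eventually_add_smul_sub_mem_of_mem_intrinsicInterior hW hx.1,
      eventually_all.2 hw] with ε h1 h2
    rw [mem_V_iff]
    refine ⟨h1, fun j => ⟨w j ε, (h2 j).1, ?_⟩⟩
    have hs : ∑ n ∈ F.scen j, (x₀ + ε • (x₀ - x)).2.2 n = ∑ n ∈ F.scen j, x₀.2.2 n
        + ε * (∑ n ∈ F.scen j, x₀.2.2 n - ∑ n ∈ F.scen j, x.2.2 n) := by
      simp [Finset.sum_add_distrib, Finset.mul_sum, mul_sub]
    rw [hs, (h2 j).2, hxu, hxv]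
    rfl
  obtain ⟨ε, h1, h2⟩ := ((hev.filter_mono nhdsWithin_le_nhds).and
    (self_mem_nhdsWithin (a := (0 : ℝ)) (s := Set.Ioi 0))).exists
  exact ⟨ε, h2, h1⟩

/-- The atoms move within the sets `D n`; positivity of the weights and the strict `g`-inequalities
persist by continuity. The cost `h` is free. -/
theorem exists_add_smul_mem_momentCone (c : Param S A →ₗ[ℝ] ℝ) {x₀ : F.Moments}
    {z : Fin F.N → Param S A} (hpos : ∀ n, 0 < x₀.2.2 n)
    (hz : ∀ n, z n ∈ intrinsicInterior ℝ (F.D n))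
    (hz₁ : ∀ j, ∑ n ∈ F.scen j, x₀.2.2 n • z n = x₀.1 j)
    (hz₂ : ∀ j m, ∑ n ∈ F.scen j, x₀.2.2 n * F.g j n (z n) m < x₀.2.1 j m)
    {y : F.Moments × ℝ} (hy : y ∈ F.momentCone c) :
    ∃ ε : ℝ, 0 < ε ∧ ∃ h, (x₀ + ε • (x₀ - y.1), h) ∈ F.momentCone c := by
  obtain ⟨-, z', hz', hy₁, -, -⟩ := hy
  choose w hlim hw using fun n => eventually_exists_smul_eq (hz n) (hz' n) (hpos n) (y.1.2.2 n)
  have hev₁ : ∀ᶠ ε : ℝ in 𝓝 0, ∀ n, 0 < x₀.2.2 n + ε * (x₀.2.2 n - y.1.2.2 n) :=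
    eventually_all.2 fun n => (Continuous.tendsto' (by fun_prop) _ _ (by simp) :
      Tendsto (fun ε : ℝ => x₀.2.2 n + ε * (x₀.2.2 n - y.1.2.2 n)) (𝓝 0)
        (𝓝 (x₀.2.2 n))).eventually (lt_mem_nhds (hpos n))
  have hev₂ : ∀ᶠ ε : ℝ in 𝓝 0, ∀ j m,
      ∑ n ∈ F.scen j, (x₀.2.2 n + ε * (x₀.2.2 n - y.1.2.2 n)) * F.g j n (w n ε) m
        < x₀.2.1 j m + ε * (x₀.2.1 j m - y.1.2.1 j m) := by
    refine eventually_all.2 fun j => eventually_all.2 fun m => ?_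
    have hω : ∀ n, Tendsto (fun ε : ℝ => x₀.2.2 n + ε * (x₀.2.2 n - y.1.2.2 n)) (𝓝 0)
        (𝓝 (x₀.2.2 n)) := fun n => Continuous.tendsto' (by fun_prop) _ _ (by simp)
    have hψ : Tendsto (fun ε : ℝ => x₀.2.1 j m + ε * (x₀.2.1 j m - y.1.2.1 j m)) (𝓝 0)
        (𝓝 (x₀.2.1 j m)) := Continuous.tendsto' (by fun_prop) _ _ (by simp)
    exact (tendsto_finsetSum _ fun n hn => (hω n).mul
      (((g_continuous hn m).tendsto (z n)).comp (hlim n))).eventually_lt hψ (hz₂ j m)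
  obtain ⟨ε, ⟨h1, h2, h3⟩, h4⟩ := (((hev₁.and (hev₂.and (eventually_all.2 hw))).filter_mono
    nhdsWithin_le_nhds).and (self_mem_nhdsWithin (a := (0 : ℝ)) (s := Set.Ioi 0))).exists
  refine ⟨ε, h4, ∑ n, (x₀ + ε • (x₀ - y.1)).2.2 n * c (w n ε), fun n => (h1 n).le, fun n => w n ε, fun n => (h3 n).1, fun j => ?_,
    fun j m => (h2 j m).le, rfl⟩
  calc _ = ∑ n ∈ F.scen j, (x₀.2.2 n • z n + ε • (x₀.2.2 n • z n - y.1.2.2 n • z' n)) :=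
        Finset.sum_congr rfl fun n _ => (h3 n).2
    _ = _ := by
        rw [Finset.sum_add_distrib, ← Finset.smul_sum, Finset.sum_sub_distrib, hz₁, hy₁]
        rfl

end AmbiguityFormat

end DRMDP

/-! ### Integration against admissible laws and weak duality -/

namespace DRMDP

theorem pair_smul {S A : Type*} [Fintype S] [Fintype A] (β z : Param S A) (r : ℝ) :
    pair β (r • z) = r * pair β z := by
  simp [pair, mul_add]

/-- The pairing with `β` as a continuous linear functional. -/
noncomputable def pairCLM {S A : Type*} [Fintype S] [Fintype A] (β : Param S A) :
    Param S A →L[ℝ] ℝ :=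
  LinearMap.toContinuousLinearMap
    { toFun := pair β
      map_add' := fun x y => by simp [pair, dotProduct_add]; ring
      map_smul' := fun r x => pair_smul β x r }

@[simp]
theorem pairCLM_apply {S A : Type*} [Fintype S] [Fintype A] (β z : Param S A) :
    pairCLM β z = pair β z := rfl

namespace AmbiguityFormat

variable {S A : Type*} [Fintype S] [Fintype A] {F : AmbiguityFormat S A}

section Measure

variable {P : Measure (Param S A × Fin F.N)}
  {H : Type*} [NormedAddCommGroup H]

theorem measurable_of_continuous_fst [MeasurableSpace H] [BorelSpace H]
    {f : Param S A × Fin F.N → H} (hf : ∀ n, Continuous fun z => f (z, n)) : Measurable f :=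
  measurable_from_prod_countable_left fun n => (hf n).measurable

theorem exists_bound {f : Param S A × Fin F.N → H} (hf : ∀ n, Continuous fun z => f (z, n)) :
    ∃ K, ∀ n, ∀ z ∈ F.D n, ‖f (z, n)‖ ≤ K := by
  choose K hK using fun n => (F.D_compact n).exists_bound_of_continuousOn (hf n).continuousOn
  refine ⟨∑ n, |K n|, fun n z hz => (hK n z hz).trans ((le_abs_self _).trans ?_)⟩
  exact Finset.single_le_sum (f := fun n => |K n|) (fun _ _ => abs_nonneg _) (Finset.mem_univ n)

/-- The compact supports make the integrand almost surely bounded. -/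
theorem integrable_of_continuous_fst [SecondCountableTopology H] [IsFiniteMeasure P]
    (hP : ∀ᵐ x ∂P, x.1 ∈ F.D x.2)
    {f : Param S A × Fin F.N → H} (hf : ∀ n, Continuous fun z => f (z, n)) :
    Integrable f P := by
  borelize H
  obtain ⟨K, hK⟩ := exists_bound hf
  exact Integrable.of_bound (measurable_of_continuous_fst hf).aestronglyMeasurable K
    (hP.mono fun x hx => hK x.2 x.1 hx)

theorem measurableSet_snd (s : Set (Fin F.N)) :
    MeasurableSet {x : Param S A × Fin F.N | x.2 ∈ s} :=
  measurable_snd (MeasurableSet.of_discrete (s := s))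

theorem measurableSet_snd_eq (n : Fin F.N) :
    MeasurableSet {x : Param S A × Fin F.N | x.2 = n} :=
  measurableSet_snd {n}

theorem measure_snd_mem {ω : Fin F.N → ℝ} (hω : ∀ n, 0 ≤ ω n)
    (hP : ∀ n, P {x | x.2 = n} = ENNReal.ofReal (ω n)) (s : Finset (Fin F.N)) :
    P {x | x.2 ∈ s} = ENNReal.ofReal (∑ n ∈ s, ω n) := by
  have : {x : Param S A × Fin F.N | x.2 ∈ s} = ⋃ n ∈ s, {x | x.2 = n} := by ext; simp
  rw [this, measure_biUnion_finset, ENNReal.ofReal_sum_of_nonneg fun n _ => hω n]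
  · exact Finset.sum_congr rfl fun n _ => hP n
  · intro i _ k _ hik
    exact Set.disjoint_left.2 fun x hx hx' => hik (hx.symm.trans hx')
  · exact fun n _ => measurableSet_snd_eq n

theorem integral_cond_scen [NormedSpace ℝ H] {ω : Fin F.N → ℝ} (hω : ∀ n, 0 ≤ ω n)
    (hP : ∀ n, P {x | x.2 = n} = ENNReal.ofReal (ω n)) (s : Finset (Fin F.N))
    (f : Param S A × Fin F.N → H) :
    ∫ x, f x ∂P[|{x | x.2 ∈ s}]
      = (∑ n ∈ s, ω n)⁻¹ • ∫ x, (if x.2 ∈ s then f x else 0) ∂P := by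
  rw [ProbabilityTheory.cond, integral_smul_measure, measure_snd_mem hω hP, ENNReal.toReal_inv,
    ENNReal.toReal_ofReal (Finset.sum_nonneg fun n _ => hω n),
    ← integral_indicator (show MeasurableSet {x : Param S A × Fin F.N | x.2 ∈ s} from
      measurableSet_snd (s : Set (Fin F.N)))]
  simp only [Set.indicator_apply, Set.mem_ofPred_eq]

theorem integral_comp_snd [IsFiniteMeasure P] {ω : Fin F.N → ℝ} (hω : ∀ n, 0 ≤ ω n)
    (hP : ∀ n, P {x | x.2 = n} = ENNReal.ofReal (ω n)) (α : Fin F.N → ℝ) :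
    ∫ x, α x.2 ∂P = ∑ n, α n * ω n := by
  have h : ∀ x : Param S A × Fin F.N,
      α x.2 = ∑ n, {x : Param S A × Fin F.N | x.2 = n}.indicator (fun _ => α n) x := by
    intro x
    simp [Set.indicator_apply]
  simp_rw [h]
  rw [integral_finsetSum]
  · refine Finset.sum_congr rfl fun n _ => ?_
    rw [integral_indicator_const _ (measurableSet_snd_eq n), Measure.real, hP,
      ENNReal.toReal_ofReal (hω n), smul_eq_mul, mul_comm]
  · exact fun n _ => (integrable_const _).indicator (measurableSet_snd_eq n)

end Measure

/-- Every scenario has positive probability, so each conditional support constraint is a genuine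
almost-sure statement on its fibre. -/
theorem ae_mem_D {P : Measure (Param S A × Fin F.N)} (hP : P ∈ F.ambiguitySet) :
    ∀ᵐ x ∂P, x.1 ∈ F.D x.2 := by
  obtain ⟨hprob, ω, hω, -, -, -, -, -, hD, hn⟩ := hP
  have hpos := (F.W_interior ω hω).1
  have hfib : ∀ n, ∀ᵐ x ∂P, x.2 = n → x.1 ∈ F.D n := by
    intro n
    have hB : MeasurableSet {x : Param S A × Fin F.N | x.2 = n} := measurableSet_snd_eq n
    have : IsProbabilityMeasure P[|{x | x.2 = n}] := cond_isProbabilityMeasure (by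
      rw [hn, ne_eq, ENNReal.ofReal_eq_zero, not_le]; exact hpos n)
    have hS : MeasurableSet {x : Param S A × Fin F.N | x.1 ∈ F.D n} :=
      measurable_fst (F.D_compact n).measurableSet
    have hae : ∀ᵐ x ∂P[|{x | x.2 = n}], x.1 ∈ F.D n := by
      rw [ae_iff]
      exact (prob_compl_eq_zero_iff hS).2 (hD n)
    rw [ProbabilityTheory.cond, Measure.ae_ennreal_smul_measure_iff (by simp), ae_restrict_iff' hB] at hae
    exact hae
  filter_upwards [ae_all_iff.2 hfib] with x hx
  exact hx x.2 rfl

theorem bddBelow_integral_ambiguitySet (c : Param S A →ₗ[ℝ] ℝ) :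
    BddBelow ((fun P : Measure (Param S A × Fin F.N) => ∫ x, c x.1 ∂P) '' F.ambiguitySet) := by
  obtain ⟨K, hK⟩ := exists_bound (F := F) (f := fun x => c x.1)
    fun _ => c.continuous_of_finiteDimensional
  refine ⟨-K, ?_⟩
  rintro _ ⟨P, hP, rfl⟩
  have := hP.1
  have h := norm_integral_le_of_norm_le_const ((ae_mem_D hP).mono fun x hx => hK x.2 x.1 hx)
  rw [probReal_univ, mul_one] at h
  exact neg_le_of_abs_le h

/-- Weak duality. -/
theorem neg_le_integral_of_feasible (c : Param S A →ₗ[ℝ] ℝ) {δ : ℝ} {α : Fin F.N → ℝ}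
    {β : Fin F.J → Param S A} {γ : (j : Fin F.J) → Fin (F.M j) → ℝ}
    (h₁ : ∀ μ ν ω, (μ, ν, ω) ∈ F.V → α ⬝ᵥ ω + ∑ j, (pair (β j) (μ j) + γ j ⬝ᵥ ν j) ≤ δ)
    (h₂ : ∀ n, ∀ z ∈ F.D n,
      -c z ≤ α n + ∑ j with n ∈ F.scen j, (pair (β j) z + γ j ⬝ᵥ F.g j n z))
    (hγ : ∀ j m, 0 ≤ γ j m) {P : Measure (Param S A × Fin F.N)} (hP : P ∈ F.ambiguitySet) :
    -δ ≤ ∫ x, c x.1 ∂P := by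
  have hD := ae_mem_D hP
  obtain ⟨hprob, ω, hω, μ, ν, hU, hμ, hν, -, hn⟩ := hP
  have hω0 : ∀ n, 0 ≤ ω n := fun n => ((F.W_interior ω hω).1 n).le
  have hpos := sum_scen_pos hω
  have hμ' : ∀ j, ∫ x, (if x.2 ∈ F.scen j then x.1 else 0) ∂P
      = (∑ n ∈ F.scen j, ω n) • μ j := fun j => by
    rw [← hμ j, integral_cond_scen hω0 hn, smul_inv_smul₀ (hpos j).ne']
  have hν' : ∀ j m, ∫ x, (if x.2 ∈ F.scen j then F.g j x.2 x.1 m else 0) ∂P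
      ≤ (∑ n ∈ F.scen j, ω n) * ν j m := fun j m => by
    have := mul_le_mul_of_nonneg_left (hν j m) (hpos j).le
    rwa [integral_cond_scen hω0 hn, smul_eq_mul, mul_inv_cancel_left₀ (hpos j).ne'] at this
  have hi₁ : ∀ j, Integrable (fun x : Param S A × Fin F.N =>
      if x.2 ∈ F.scen j then x.1 else 0) P := fun j =>
    integrable_of_continuous_fst hD fun n => by
      by_cases hn : n ∈ F.scen j <;> simp only [hn, if_true, if_false] <;> fun_prop
  have hi₂ : ∀ j m, Integrable (fun x : Param S A × Fin F.N =>
      if x.2 ∈ F.scen j then F.g j x.2 x.1 m else 0) P := fun j m =>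
    integrable_of_continuous_fst hD fun n => by
      by_cases hn : n ∈ F.scen j <;> simp only [hn, if_true, if_false]
      exacts [g_continuous hn m, continuous_const]
  have hi₃ : Integrable (fun x : Param S A × Fin F.N => c x.1) P :=
    integrable_of_continuous_fst hD fun _ => c.continuous_of_finiteDimensional
  have hi₄ : Integrable (fun x : Param S A × Fin F.N => α x.2) P :=
    integrable_of_continuous_fst hD fun n => (continuous_const : Continuous fun _ => α n)
  -- `V` consists of unnormalized moments, hence the scaling by the mass of `scen j`.
  have hV := h₁ (fun j => (∑ n ∈ F.scen j, ω n) • μ j)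
    (fun j => (∑ n ∈ F.scen j, ω n) • ν j) ω
    (mem_V_iff.2 ⟨hω, fun j => ⟨(μ j, ν j), hU j, rfl⟩⟩)
  have hae : ∀ᵐ x ∂P, -c x.1 ≤ α x.2 + ∑ j, (pairCLM (β j) (if x.2 ∈ F.scen j then x.1 else 0)
      + ∑ m, γ j m * (if x.2 ∈ F.scen j then F.g j x.2 x.1 m else 0)) := by
    filter_upwards [hD] with x hx
    refine (h₂ x.2 x.1 hx).trans_eq ?_
    rw [Finset.sum_filter]
    congr 1
    refine Finset.sum_congr rfl fun j _ => ?_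
    by_cases hj : x.2 ∈ F.scen j <;> simp [hj, dotProduct, pair]
  have hi₅ : ∀ j, Integrable (fun x : Param S A × Fin F.N =>
      pairCLM (β j) (if x.2 ∈ F.scen j then x.1 else 0)) P := fun j =>
    (pairCLM (β j)).integrable_comp (hi₁ j)
  have hi₆ : ∀ j, Integrable (fun x : Param S A × Fin F.N =>
      ∑ m, γ j m * (if x.2 ∈ F.scen j then F.g j x.2 x.1 m else 0)) P := fun j =>
    integrable_finsetSum _ fun m _ => (hi₂ j m).const_mul _
  have hi₇ : ∀ j, Integrable (fun x : Param S A × Fin F.N =>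
      pairCLM (β j) (if x.2 ∈ F.scen j then x.1 else 0)
        + ∑ m, γ j m * (if x.2 ∈ F.scen j then F.g j x.2 x.1 m else 0)) P := fun j =>
    (hi₅ j).add (hi₆ j)
  have hint := integral_mono_ae hi₃.neg (hi₄.add (integrable_finsetSum Finset.univ
    fun j _ => hi₇ j)) hae
  simp only [Pi.add_apply, Pi.neg_apply, integral_neg] at hint
  rw [integral_add hi₄ (integrable_finsetSum Finset.univ fun j _ => hi₇ j),
    integral_comp_snd hω0 hn, integral_finsetSum _ fun j _ => hi₇ j] at hint
  have hle : ∑ j, ∫ x, (pairCLM (β j) (if x.2 ∈ F.scen j then x.1 else 0)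
      + ∑ m, γ j m * (if x.2 ∈ F.scen j then F.g j x.2 x.1 m else 0)) ∂P
      ≤ ∑ j, (pair (β j) ((∑ n ∈ F.scen j, ω n) • μ j)
        + γ j ⬝ᵥ ((∑ n ∈ F.scen j, ω n) • ν j)) := by
    refine Finset.sum_le_sum fun j _ => ?_
    rw [integral_add (hi₅ j) (hi₆ j), (pairCLM (β j)).integral_comp_comm (hi₁ j), hμ',
      integral_finsetSum _ fun m _ => (hi₂ j m).const_mul _, pairCLM_apply]
    refine add_le_add le_rfl (Finset.sum_le_sum fun m _ => ?_)
    rw [integral_const_mul]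
    exact mul_le_mul_of_nonneg_left (hν' j m) (hγ j m)
  have hα : α ⬝ᵥ ω = ∑ n, α n * ω n := rfl
  linarith

/-! ### One-atom-per-scenario laws -/

/-- The law that puts mass `ω n` on the point `z n` of scenario `n`. -/
noncomputable def discreteLaw (F : AmbiguityFormat S A) (ω : Fin F.N → ℝ)
    (z : Fin F.N → Param S A) : Measure (Param S A × Fin F.N) :=
  ∑ n, ENNReal.ofReal (ω n) • Measure.dirac (z n, n)

theorem integral_discreteLaw {H : Type*} [NormedAddCommGroup H] [NormedSpace ℝ H]
    [CompleteSpace H] {ω : Fin F.N → ℝ} (hω : ∀ n, 0 ≤ ω n) (z : Fin F.N → Param S A)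
    (f : Param S A × Fin F.N → H) :
    ∫ x, f x ∂F.discreteLaw ω z = ∑ n, ω n • f (z n, n) := by
  rw [discreteLaw, integral_finsetSum_measure]
  · refine Finset.sum_congr rfl fun n _ => ?_
    rw [integral_smul_measure, integral_dirac, ENNReal.toReal_ofReal (hω n)]
  · exact fun n _ => (integrable_dirac (by simp)).smul_measure ENNReal.ofReal_ne_top

open scoped Classical in
theorem discreteLaw_apply (ω : Fin F.N → ℝ) (z : Fin F.N → Param S A)
    (B : Set (Param S A × Fin F.N)) :
    F.discreteLaw ω z B = ∑ n, if (z n, n) ∈ B then ENNReal.ofReal (ω n) else 0 := by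
  simp [discreteLaw, Measure.dirac_apply, Set.indicator_apply]

theorem discreteLaw_mem_ambiguitySet {x : F.Moments} (hx : x ∈ F.V) {z : Fin F.N → Param S A}
    (hz : ∀ n, z n ∈ F.D n) (h₁ : ∀ j, ∑ n ∈ F.scen j, x.2.2 n • z n = x.1 j)
    (h₂ : ∀ j m, ∑ n ∈ F.scen j, x.2.2 n * F.g j n (z n) m ≤ x.2.1 j m) :
    F.discreteLaw x.2.2 z ∈ F.ambiguitySet := by
  rw [mem_V_iff] at hx
  obtain ⟨hW, hU⟩ := hx
  choose u hu hxu using hU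
  have hpos := (F.W_interior _ hW).1
  have hω : ∀ n, 0 ≤ x.2.2 n := fun n => (hpos n).le
  have hfib : ∀ n, F.discreteLaw x.2.2 z {x | x.2 = n} = ENNReal.ofReal (x.2.2 n) := fun n => by
    rw [discreteLaw_apply, Finset.sum_eq_single n] <;> simp +contextual
  have hu₁ : ∀ j, (∑ n ∈ F.scen j, x.2.2 n) • (u j).1 = x.1 j := fun j =>
    congrArg Prod.fst (hxu j)
  have hu₂ : ∀ j m, (∑ n ∈ F.scen j, x.2.2 n) * (u j).2 m = x.2.1 j m := fun j m =>
    congrFun (congrArg Prod.snd (hxu j)) m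
  refine ⟨⟨?_⟩, x.2.2, hW, fun j => (u j).1, fun j => (u j).2, hu, fun j => ?_, fun j m => ?_,
    fun n => ?_, hfib⟩
  · simp only [discreteLaw_apply, Set.mem_univ, if_true]
    rw [← ENNReal.ofReal_sum_of_nonneg fun n _ => hω n, (F.W_interior _ hW).2, ENNReal.ofReal_one]
  · rw [integral_cond_scen hω hfib, integral_discreteLaw hω,
      inv_smul_eq_iff₀ (sum_scen_pos hW j).ne', hu₁, ← h₁]
    simp [Finset.sum_ite_mem]
  · rw [integral_cond_scen hω hfib, integral_discreteLaw hω, smul_eq_mul,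
      inv_mul_le_iff₀ (sum_scen_pos hW j), hu₂]
    refine le_trans (le_of_eq ?_) (h₂ j m)
    simp [Finset.sum_ite_mem]
  · have hB : MeasurableSet {x : Param S A × Fin F.N | x.2 = n} := measurableSet_snd_eq n
    have hinter : F.discreteLaw x.2.2 z ({x | x.2 = n} ∩ {x | x.1 ∈ F.D n})
        = ENNReal.ofReal (x.2.2 n) := by
      rw [discreteLaw_apply, Finset.sum_eq_single n]
      · simp [hz]
      · intro i _ hi
        simp [hi]
      · simp
    rw [cond_apply hB, hfib, hinter, ENNReal.inv_mul_cancel (by simpa using hpos n)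
      ENNReal.ofReal_ne_top]

/-- This is the bound on fibres required by `exists_linear_price`; reducing arbitrary laws to
discrete ones is unnecessary, as weak duality treats them directly. -/
theorem sInf_integral_le (c : Param S A →ₗ[ℝ] ℝ) {x : F.Moments} (hx : x ∈ F.V) {h : ℝ}
    (hxh : (x, h) ∈ F.momentCone c) :
    sInf ((fun P : Measure (Param S A × Fin F.N) => ∫ x, c x.1 ∂P) '' F.ambiguitySet) ≤ h := by
  obtain ⟨hω, z, hz, h₁, h₂, h₃⟩ := hxh
  refine csInf_le (bddBelow_integral_ambiguitySet c)
    ⟨_, discreteLaw_mem_ambiguitySet hx hz h₁ h₂, ?_⟩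
  simp only
  rw [integral_discreteLaw hω]
  exact h₃

theorem Slater.ambiguitySet_nonempty (h : F.Slater) : F.ambiguitySet.Nonempty := by
  obtain ⟨x, z, hW, hU, hz, h₁, h₂⟩ := h.exists_point
  refine ⟨_, discreteLaw_mem_ambiguitySet (x := x) (z := z) (mem_V_iff.2
    ⟨intrinsicInterior_subset hW, fun j => ?_⟩) (fun n => intrinsicInterior_subset (hz n)) h₁
    fun j m => (h₂ j m).le⟩
  obtain ⟨u, hu, hxu⟩ := hU j
  exact ⟨u, intrinsicInterior_subset hu, hxu⟩

/-! ### Coordinates of functionals and strong duality -/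

theorem _root_.LinearMap.eq_dotProduct {ι : Type*} [Fintype ι] [DecidableEq ι]
    (f : (ι → ℝ) →ₗ[ℝ] ℝ) (v : ι → ℝ) : f v = (fun i => f (Pi.single i 1)) ⬝ᵥ v := by
  have h := LinearMap.pi_apply_eq_sum_univ f v
  rw [h]
  refine Finset.sum_congr rfl fun i _ => ?_
  rw [smul_eq_mul, mul_comm]
  congr 2
  ext j
  simp [Pi.single_apply, eq_comm]

theorem _root_.LinearMap.eq_sum_single {ι : Type*} [Fintype ι] [DecidableEq ι] {X : ι → Type*}
    [∀ i, AddCommGroup (X i)] [∀ i, Module ℝ (X i)] (f : ((i : ι) → X i) →ₗ[ℝ] ℝ)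
    (v : (i : ι) → X i) : f v = ∑ i, (f ∘ₗ LinearMap.single ℝ X i) (v i) := by
  conv_lhs => rw [← Finset.univ_sum_single v, map_sum]
  rfl

theorem exists_eq_pair (f : Param S A →ₗ[ℝ] ℝ) : ∃ β, ∀ z, f z = pair β z := by
  classical
  refine ⟨(fun i => (f ∘ₗ LinearMap.inl ℝ _ _) (Pi.single i 1),
    fun a => (f ∘ₗ LinearMap.inr ℝ _ _) (Pi.single a 1)), fun z => ?_⟩
  rw [pair, ← LinearMap.eq_dotProduct, ← LinearMap.eq_dotProduct]
  simp [← map_add]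

/-- Coordinates of a linear functional on the moments. -/
theorem exists_coordinates (l : F.Moments →ₗ[ℝ] ℝ) :
    ∃ (α : Fin F.N → ℝ) (β : Fin F.J → Param S A) (γ : (j : Fin F.J) → Fin (F.M j) → ℝ),
      ∀ x : F.Moments, l x = α ⬝ᵥ x.2.2 + ∑ j, (pair (β j) (x.1 j) + γ j ⬝ᵥ x.2.1 j) := by
  let l₁ := l ∘ₗ LinearMap.inl ℝ _ _
  let l₂ := l ∘ₗ LinearMap.inr ℝ _ _ ∘ₗ LinearMap.inl ℝ _ _
  let l₃ := l ∘ₗ LinearMap.inr ℝ _ _ ∘ₗ LinearMap.inr ℝ _ _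
  choose β hβ using fun j => exists_eq_pair (l₁ ∘ₗ LinearMap.single ℝ (fun _ => Param S A) j)
  refine ⟨fun n => l₃ (Pi.single n 1), β,
    fun j m => (l₂ ∘ₗ LinearMap.single ℝ (fun j => Fin (F.M j) → ℝ) j) (Pi.single m 1), fun x => ?_⟩
  have hx : l x = l₃ x.2.2 + (l₁ x.1 + l₂ x.2.1) := by
    simp only [l₁, l₂, l₃, LinearMap.comp_apply, ← map_add]
    congr 1
    simp
  rw [hx, LinearMap.eq_dotProduct l₃, LinearMap.eq_sum_single l₁, LinearMap.eq_sum_single l₂,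
    ← Finset.sum_add_distrib]
  congr 1
  refine Finset.sum_congr rfl fun j _ => ?_
  rw [hβ, ← LinearMap.eq_dotProduct]

/-- Strong duality with attainment of the dual. -/
theorem Slater.exists_dual (h : F.Slater) (c : Param S A →ₗ[ℝ] ℝ) :
    ∃ (α : Fin F.N → ℝ) (β : Fin F.J → Param S A) (γ : (j : Fin F.J) → Fin (F.M j) → ℝ),
      (∀ μ ν ω, (μ, ν, ω) ∈ F.V → α ⬝ᵥ ω + ∑ j, (pair (β j) (μ j) + γ j ⬝ᵥ ν j)
        ≤ -sInf ((fun P : Measure (Param S A × Fin F.N) => ∫ x, c x.1 ∂P) ''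
            F.ambiguitySet)) ∧
      (∀ n, ∀ z ∈ F.D n,
        -c z ≤ α n + ∑ j with n ∈ F.scen j, (pair (β j) z + γ j ⬝ᵥ F.g j n z)) ∧
      (∀ j m, 0 ≤ γ j m) := by
  classical
  set p := sInf ((fun P : Measure (Param S A × Fin F.N) => ∫ x, c x.1 ∂P) '' F.ambiguitySet)
  obtain ⟨x₀, z₀, hW, hU, hz, h₁, h₂⟩ := h.exists_point
  have hW' := intrinsicInterior_subset hW
  have hz' : ∀ n, z₀ n ∈ F.D n := fun n => intrinsicInterior_subset (hz n)
  have hpos := (F.W_interior _ hW').1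
  have hx₀ : x₀ ∈ F.V := mem_V_iff.2 ⟨hW', fun j => by
    obtain ⟨u, hu, hxu⟩ := hU j
    exact ⟨u, intrinsicInterior_subset hu, hxu⟩⟩
  obtain ⟨l, hl⟩ := exists_linear_price convex_V (convex_momentCone c)
    (fun x hx h hxh => sInf_integral_le c hx hxh) hx₀
    ⟨∑ n, x₀.2.2 n * c (z₀ n), fun n => (hpos n).le, z₀, hz', h₁, fun j m => (h₂ j m).le, rfl⟩
    (fun x hx => exists_add_smul_mem_V hW hU hx)
    (fun y hy => exists_add_smul_mem_momentCone c hpos hz h₁ h₂ hy)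
  obtain ⟨α, β, γ, hcoord⟩ := exists_coordinates l
  -- A functional bounded below on a ray is nonnegative along it: were it negative at `y`, the
  -- factor below would bring it to `l x₀ + p - 1`.
  have hray : ∀ y : F.Moments × ℝ, (∀ r : ℝ, 0 ≤ r → r • y ∈ F.momentCone c) →
      0 ≤ l y.1 + y.2 := by
    intro y hy
    by_contra! hneg
    have h0 := hl x₀ hx₀ _ (hy 0 le_rfl)
    simp only [zero_smul, Prod.fst_zero, map_zero, Prod.snd_zero, add_zero] at h0
    have h1 := hl x₀ hx₀ _ (hy ((l x₀ + p - 1) / (l y.1 + y.2))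
      (div_nonneg_of_nonpos (by linarith) hneg.le))
    simp only [Prod.smul_fst, map_smul, Prod.smul_snd, ← smul_add] at h1
    rw [smul_eq_mul, div_mul_cancel₀ _ hneg.ne] at h1
    linarith
  refine ⟨α, β, γ, fun μ ν ω hV => ?_, fun n z hzn => ?_, fun j m => ?_⟩
  -- The apex of the cone gives `l x + p ≤ 0` on `V`.
  · have h0 := hl _ hV 0 ⟨fun n => le_rfl, z₀, hz', by simp, by simp, by simp⟩
    rw [hcoord] at h0
    simp only [Prod.fst_zero, map_zero, Prod.snd_zero, add_zero] at h0
    linarith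
  -- The ray generated by a unit atom at `z` in scenario `n`.
  · have h0 := hray ((fun j => if n ∈ F.scen j then z else 0,
      fun j => if n ∈ F.scen j then F.g j n z else 0, Pi.single n 1), c z) ?_
    · rw [hcoord] at h0
      have hsum : ∑ j with n ∈ F.scen j, (pair (β j) z + γ j ⬝ᵥ F.g j n z)
          = ∑ j, (pair (β j) (if n ∈ F.scen j then z else 0)
            + γ j ⬝ᵥ (if n ∈ F.scen j then F.g j n z else 0)) := by
        rw [Finset.sum_filter]
        refine Finset.sum_congr rfl fun j _ => ?_
        by_cases hj : n ∈ F.scen j <;> simp [hj, pair]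
      rw [hsum]
      simp only [dotProduct_single, mul_one] at h0
      linarith
    · intro r hr
      refine ⟨fun i => ?_, Function.update z₀ n z, fun i => ?_, fun j => ?_, fun j m => ?_, ?_⟩
      · exact mul_nonneg hr (by by_cases hi : i = n <;> simp [hi])
      · by_cases hi : i = n
        · subst hi; simpa using hzn
        · simpa [hi] using hz' i
      · by_cases hj : n ∈ F.scen j
        · rw [Finset.sum_eq_single_of_mem n hj]
          · simp [hj]
          · intro i _ hi
            simp [hi]
        · rw [Finset.sum_eq_zero fun i hi => ?_]
          · simp [hj]
          · have : i ≠ n := fun h => hj (h ▸ hi)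
            simp [this]
      · by_cases hj : n ∈ F.scen j
        · rw [Finset.sum_eq_single_of_mem n hj]
          · simp [hj]
          · intro i _ hi
            simp [hi]
        · rw [Finset.sum_eq_zero fun i hi => ?_]
          · simp [hj]
          · have : i ≠ n := fun h => hj (h ▸ hi)
            simp [this]
      · rw [Finset.sum_eq_single n]
        · simp
        · intro i _ hi
          simp [hi]
        · simp
  -- The ray of zero mass along the upward relaxation of coordinate `(j, m)`.
  · have h0 := hray ((0, Pi.single j (Pi.single m 1), 0), 0) ?_
    · rw [hcoord] at h0
      have hterm : ∀ i, pair (β i) ((0 : Fin F.J → Param S A) i)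
          + γ i ⬝ᵥ (Pi.single j (Pi.single m 1) : (j : Fin F.J) → Fin (F.M j) → ℝ) i
          = if i = j then γ j m else 0 := by
        intro i
        by_cases hi : i = j
        · subst hi
          simp [pair]
        · simp [pair, hi]
      simp only [hterm, dotProduct_zero, zero_add, add_zero] at h0
      simpa using h0
    · intro r hr
      refine ⟨fun n => by simp, z₀, hz', by simp, fun j' m' => ?_, by simp⟩
      have : (0 : ℝ) ≤ (Pi.single j (Pi.single m 1) : (j : Fin F.J) → Fin (F.M j) → ℝ) j' m' := by
        have h : (0 : (j : Fin F.J) → Fin (F.M j) → ℝ) ≤ Pi.single j (Pi.single m 1) :=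
          Pi.single_nonneg.2 (Pi.single_nonneg.2 zero_le_one)
        exact h j' m'
      simpa using mul_nonneg hr this

end AmbiguityFormat

end DRMDP

/-! ### The one-stage problem and its robust counterpart -/

namespace DRMDP

namespace Model

variable {S : Type*} {A : S → Type*} [Fintype S] [∀ s, Fintype (A s)] {𝓜 : Model S A}

theorem objective_eq_payoff (t : ℕ) (s : S) (π : A s → ℝ) (z : Param S (A s)) :
    𝓜.objective t s π z = 𝓜.payoff t s (𝓜.value (t + 1)) π z := by
  classical
  have hV : ∀ i : A s × S, (𝓜.V t s).mulVec π i
      = if 𝓜.stage i.2 = t + 1 then 𝓜.value (t + 1) i.2 * π i.1 else 0 := by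
    intro i
    rw [Matrix.mulVec, dotProduct, Finset.sum_eq_single i.1]
    · by_cases h : 𝓜.stage i.2 = t + 1 <;> simp [V, h]
    · intro a _ ha
      simp [V, ha.symm]
    · simp
  simp only [objective, payoff, dotProduct, hV, Fintype.sum_prod_type, ← Finset.sum_add_distrib,
    Finset.sum_filter, mul_add, Finset.mul_sum]
  refine Finset.sum_congr rfl fun a _ => ?_
  congr 1
  · ring
  · refine Finset.sum_congr rfl fun s' _ => ?_
    split_ifs
    · ring
    · simp

theorem worstCase_eq_infObjective (t : ℕ) (s : S) (π : A s → ℝ) :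
    𝓜.worstCase t s (𝓜.value (t + 1)) π = 𝓜.infObjective t s π := by
  simp only [worstCase, infObjective, objective_eq_payoff]

variable (𝓜) in
/-- The objective as a linear functional of the parameters. -/
noncomputable def objectiveLM (t : ℕ) (s : S) (π : A s → ℝ) : Param S (A s) →ₗ[ℝ] ℝ where
  toFun := 𝓜.objective t s π
  map_add' x y := by simp only [objective, Prod.fst_add, Prod.snd_add, add_dotProduct]; ring
  map_smul' r x := by
    simp only [objective, Prod.smul_fst, Prod.smul_snd, smul_dotProduct, smul_eq_mul,
      RingHom.id_apply]
    ring

theorem objective_add_smul (t : ℕ) (s : S) (a b : ℝ) (π π' : A s → ℝ) (z : Param S (A s)) :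
    𝓜.objective t s (a • π + b • π') z
      = a * 𝓜.objective t s π z + b * 𝓜.objective t s π' z := by
  simp only [objective, Matrix.mulVec_add, Matrix.mulVec_smul, dotProduct_add, dotProduct_smul,
    smul_eq_mul]
  ring

theorem bddBelow_integral_objective (t : ℕ) (s : S) (π : A s → ℝ) :
    BddBelow ((fun P : Measure (Param S (A s) × Fin (𝓜.format s).N) =>
      ∫ x, 𝓜.objective t s π x.1 ∂P) '' (𝓜.format s).ambiguitySet) :=
  AmbiguityFormat.bddBelow_integral_ambiguitySet (𝓜.objectiveLM t s π)

theorem continuous_integral_objective (t : ℕ) (s : S)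
    {P : Measure (Param S (A s) × Fin (𝓜.format s).N)} (hP : P ∈ (𝓜.format s).ambiguitySet) :
    Continuous fun π => ∫ x, 𝓜.objective t s π x.1 ∂P := by
  have hprob := hP.1
  have hint : ∀ π, Integrable (fun x : Param S (A s) × Fin (𝓜.format s).N =>
      𝓜.objective t s π x.1) P := fun π =>
    AmbiguityFormat.integrable_of_continuous_fst (AmbiguityFormat.ae_mem_D hP)
      fun _ => (𝓜.objectiveLM t s π).continuous_of_finiteDimensional
  have hlin : ∀ (a b : ℝ) (π π' : A s → ℝ), ∫ x, 𝓜.objective t s (a • π + b • π') x.1 ∂P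
      = a * ∫ x, 𝓜.objective t s π x.1 ∂P + b * ∫ x, 𝓜.objective t s π' x.1 ∂P := by
    intro a b π π'
    simp only [objective_add_smul]
    rw [integral_add ((hint π).const_mul a) ((hint π').const_mul b), integral_const_mul,
      integral_const_mul]
  let L : (A s → ℝ) →ₗ[ℝ] ℝ :=
    { toFun := fun π => ∫ x, 𝓜.objective t s π x.1 ∂P
      map_add' := fun π π' => by simpa using hlin 1 1 π π'
      map_smul' := fun a π => by simpa using hlin a 0 π π }
  exact L.continuous_of_finiteDimensional

theorem upperSemicontinuous_infObjective (t : ℕ) (s : S) :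
    UpperSemicontinuous (𝓜.infObjective t s) := by
  simp only [funext fun π => show 𝓜.infObjective t s π
    = ⨅ P : (𝓜.format s).ambiguitySet, ∫ x, 𝓜.objective t s π x.1 ∂P.1 from sInf_image']
  refine upperSemicontinuous_ciInf (fun π => ?_)
    fun P => (continuous_integral_objective t s P.2).upperSemicontinuous
  have h := bddBelow_integral_objective (𝓜 := 𝓜) t s π
  rwa [Set.image_eq_range] at h

/-- Weierstrass on the simplex. An empty ambiguity set is harmless here, since then `sInf ∅ = 0`
makes the objective constant. -/
theorem isGreatest_infObjective [∀ s, Nonempty (A s)] {t : ℕ} (ht : t < 𝓜.T) (s : S) :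
    IsGreatest (𝓜.infObjective t s '' stdSimplex ℝ (A s)) (𝓜.value t s) := by
  classical
  have hne : (stdSimplex ℝ (A s)).Nonempty :=
    ⟨_, single_mem_stdSimplex ℝ (Classical.arbitrary (A s))⟩
  obtain ⟨π, hπ, hmax⟩ := ((upperSemicontinuous_infObjective (𝓜 := 𝓜) t s).upperSemicontinuousOn
    _).exists_isMaxOn hne (isCompact_stdSimplex ℝ (A s))
  have hg : IsGreatest (𝓜.infObjective t s '' stdSimplex ℝ (A s)) (𝓜.infObjective t s π) :=
    ⟨⟨π, hπ, rfl⟩, by rintro _ ⟨π', hπ', rfl⟩; exact hmax hπ'⟩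
  have hv : 𝓜.value t s = 𝓜.infObjective t s π := by
    rw [𝓜.value_of_lt t ht s, funext fun π => worstCase_eq_infObjective t s π]
    exact hg.csSup_eq
  rwa [hv]

theorem neg_le_infObjective {t : ℕ} {s : S} (h : (𝓜.format s).Slater)
    {x : (𝓜.format s).RobustVars} (hx : x ∈ 𝓜.robustFeasible t s) :
    -x.2.1 ≤ 𝓜.infObjective t s x.1 := by
  obtain ⟨h₁, h₂, -, hγ⟩ := hx
  -- Nonemptiness matters: the default `sInf ∅ = 0` need not dominate `-δ`.
  refine le_csInf (h.ambiguitySet_nonempty.image _) ?_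
  rintro _ ⟨P, hP, rfl⟩
  exact AmbiguityFormat.neg_le_integral_of_feasible (𝓜.objectiveLM t s x.1) h₁ h₂ hγ hP

theorem exists_mem_robustFeasible {t : ℕ} {s : S} (h : (𝓜.format s).Slater) {π : A s → ℝ}
    (hπ : π ∈ stdSimplex ℝ (A s)) :
    ∃ α β γ, (π, -𝓜.infObjective t s π, α, β, γ) ∈ 𝓜.robustFeasible t s := by
  obtain ⟨α, β, γ, h₁, h₂, hγ⟩ := h.exists_dual (𝓜.objectiveLM t s π)
  exact ⟨α, β, γ, h₁, h₂, hπ, hγ⟩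

theorem pair_add_smul {S A : Type*} [Fintype S] [Fintype A] (a b : ℝ) (β β' z : Param S A) :
    pair (a • β + b • β') z = a * pair β z + b * pair β' z := by
  simp only [pair, Prod.fst_add, Prod.snd_add, Prod.smul_fst, Prod.smul_snd, add_dotProduct,
    smul_dotProduct, smul_eq_mul]
  ring

/-- For fixed uncertain data, both robust constraints are linear inequalities in the decision
variables. -/
theorem convex_robustFeasible (t : ℕ) (s : S) : Convex ℝ (𝓜.robustFeasible t s) := by
  rintro ⟨π, δ, α, β, γ⟩ ⟨h₁, h₂, h₃, h₄⟩ ⟨π', δ', α', β', γ'⟩ ⟨h₁', h₂', h₃', h₄'⟩ a b ha hb hab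
  have hsum : ∀ (J : Finset (Fin (𝓜.format s).J)) (μ : Fin (𝓜.format s).J → Param S (A s))
      (ν : (j : Fin (𝓜.format s).J) → Fin ((𝓜.format s).M j) → ℝ),
      ∑ j ∈ J, (pair ((a • β + b • β') j) (μ j) + (a • γ + b • γ') j ⬝ᵥ ν j)
        = a * ∑ j ∈ J, (pair (β j) (μ j) + γ j ⬝ᵥ ν j)
          + b * ∑ j ∈ J, (pair (β' j) (μ j) + γ' j ⬝ᵥ ν j) := by
    intro J μ ν
    rw [Finset.mul_sum, Finset.mul_sum, ← Finset.sum_add_distrib]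
    refine Finset.sum_congr rfl fun j _ => ?_
    simp only [Pi.add_apply, Pi.smul_apply, pair_add_smul, add_dotProduct, smul_dotProduct,
      smul_eq_mul]
    ring
  refine ⟨fun μ ν ω hV => ?_, fun n z hz => ?_, convex_stdSimplex ℝ (A s) h₃ h₃' ha hb hab,
    fun j m => add_nonneg (mul_nonneg ha (h₄ j m)) (mul_nonneg hb (h₄' j m))⟩
  · have e₁ := mul_le_mul_of_nonneg_left (h₁ μ ν ω hV) ha
    have e₂ := mul_le_mul_of_nonneg_left (h₁' μ ν ω hV) hb
    calc (a • α + b • α') ⬝ᵥ ω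
          + ∑ j, (pair ((a • β + b • β') j) (μ j) + (a • γ + b • γ') j ⬝ᵥ ν j)
        = a * (α ⬝ᵥ ω + ∑ j, (pair (β j) (μ j) + γ j ⬝ᵥ ν j))
          + b * (α' ⬝ᵥ ω + ∑ j, (pair (β' j) (μ j) + γ' j ⬝ᵥ ν j)) := by
          rw [hsum]
          simp only [add_dotProduct, smul_dotProduct, smul_eq_mul]
          ring
      _ ≤ a * δ + b * δ' := add_le_add e₁ e₂
  · have e₁ := mul_le_mul_of_nonneg_left (h₂ n z hz) ha
    have e₂ := mul_le_mul_of_nonneg_left (h₂' n z hz) hb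
    change -𝓜.objective t s (a • π + b • π') z ≤ (a * α n + b * α' n)
      + ∑ j with n ∈ (𝓜.format s).scen j, (pair ((a • β + b • β') j) z
        + (a • γ + b • γ') j ⬝ᵥ (𝓜.format s).g j n z)
    rw [objective_add_smul, hsum _ (fun _ => z) fun j => (𝓜.format s).g j n z]
    linarith

end Model

end DRMDP

theorem mainTheorem2 {S : Type*} [Fintype S] {A : S → Type*} [∀ s, Fintype (A s)]
    [∀ s, Nonempty (A s)] (𝓜 : DRMDP.Model S A) (t : ℕ) (ht : t < 𝓜.T)
    (s : S) (hs : 𝓜.stage s = t) :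
    (∀ π : A s → ℝ, 𝓜.IsSRobustAction t s π ↔
      π ∈ stdSimplex ℝ (A s) ∧
        ∀ π' ∈ stdSimplex ℝ (A s), 𝓜.infObjective t s π' ≤ 𝓜.infObjective t s π) ∧
    ((∀ s', 𝓜.stage s' < 𝓜.T → (𝓜.format s').Slater) →
      (∀ π : A s → ℝ, 𝓜.IsSRobustAction t s π ↔
        ∃ δ α β γ, 𝓜.IsRobustOptimal t s (π, δ, α, β, γ)) ∧
      IsGreatest (𝓜.infObjective t s '' stdSimplex ℝ (A s)) (𝓜.value t s) ∧
      IsGreatest ((fun x => -x.2.1) '' 𝓜.robustFeasible t s) (𝓜.value t s) ∧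
      Convex ℝ (𝓜.format s).V ∧
      Convex ℝ (𝓜.robustFeasible t s)) := by
  have hA : ∀ π : A s → ℝ, 𝓜.IsSRobustAction t s π ↔ π ∈ stdSimplex ℝ (A s) ∧
      ∀ π' ∈ stdSimplex ℝ (A s), 𝓜.infObjective t s π' ≤ 𝓜.infObjective t s π := fun π => by
    simp only [DRMDP.Model.IsSRobustAction, DRMDP.Model.worstCase_eq_infObjective]
  refine ⟨hA, fun hSlater => ?_⟩
  have h : (𝓜.format s).Slater := hSlater s (hs ▸ ht)
  have hgA := DRMDP.Model.isGreatest_infObjective ht s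
  refine ⟨fun π => ?_, hgA, ⟨?_, ?_⟩, DRMDP.AmbiguityFormat.convex_V,
    DRMDP.Model.convex_robustFeasible t s⟩
  · rw [hA]
    constructor
    · rintro ⟨hπ, hmax⟩
      obtain ⟨α, β, γ, hx⟩ := DRMDP.Model.exists_mem_robustFeasible h hπ
      -- The omitted `δ` is minus the worst case of `π`, so weak duality at `y` and maximality of
      -- `π` conclude.
      refine ⟨_, α, β, γ, hx, fun y hy => ?_⟩
      rw [neg_neg]
      exact (DRMDP.Model.neg_le_infObjective h hy).trans (hmax _ hy.2.2.1)
    · rintro ⟨δ, α, β, γ, hx, hopt⟩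
      refine ⟨hx.2.2.1, fun π' hπ' => ?_⟩
      obtain ⟨α', β', γ', hy⟩ := DRMDP.Model.exists_mem_robustFeasible h hπ'
      have h₁ := hopt _ hy
      have h₂ := DRMDP.Model.neg_le_infObjective h hx
      rw [neg_neg] at h₁
      exact h₁.trans h₂
  · obtain ⟨π, hπ, hval⟩ := hgA.1
    obtain ⟨α, β, γ, hx⟩ := DRMDP.Model.exists_mem_robustFeasible h hπ
    exact ⟨_, hx, by rw [← hval]; exact neg_neg _⟩
  · rintro _ ⟨x, hx, rfl⟩
    exact (DRMDP.Model.neg_le_infObjective h hx).trans (hgA.2 ⟨x.1, hx.2.2.1, rfl⟩)
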